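/- **Theorem 1.3.** Let $\mathcal X$ be a finite set of size $N \ge 2$. Let $\mathcal R_N$ be the set of $N\times N$ Markov transition matrices (row-stochastic matrices) on $\mathcal X$ that are reversible with respect to a stationary distribution $\pi$ with $\pi(x)>0$ for all $x\in\mathcal X$, i.e. $\pi(x)P(x,y)=\pi(y)P(y,x)$ for all $x,y$; let $\overline{\mathcal R_N}$ be its closure in $\mathbb R^{N^2}$. Let $P\in\overline{\mathcal R_N}$, and let $\beta_1,\dots,\beta_N$, with $\beta_N=1$, be its eigenvalues counted with algebraic multiplicity. Put $\beta_\star=\max\{|\beta_j| : 1\le j\le N-1\}$, assume $\beta_\star<1$, and let $t_{\mathrm{rel}}=1/(1-\beta_\star)$. Then $P$ has a unique stationary distribution $\pi$, and for every $0<\varepsilon<1$ the mixing time $$t_{\mathrm{mix}}(\varepsilon)=\min\Big\{t\in\mathbb Z_{\ge 0} : \tfrac12\sum_{y\in\mathcal X}|P^t(x,y)-\pi(y)|\le\varepsilon\ \text{ for all } x\in\mathcal X\Big\}$$ exists (the set is non-empty) and satisfies $$t_{\mathrm{mix}}(\varepsilon)\le 2\Big(N+2\log\varepsilon^{-1}-1+\sqrt{2(N-2)\log\varepsilon^{-1}}\Big)\,t_{\mathrm{rel}}.$$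 If moreover all eigenvalues of $P$ are nonnegative real numbers, then $$t_{\mathrm{mix}}(\varepsilon)\le \Big(N+2\log\varepsilon^{-1}-1+\sqrt{2(N-2)\log\varepsilon^{-1}}\Big)\,t_{\mathrm{rel}}.$$ -/

import Mathlib

namespace MarkovMixing

noncomputable section

variable {X : Type*} [Fintype X] [DecidableEq X]

/-- `π` is a stationary distribution of `P`: a probability vector with `π P = π`. -/
def IsStationary (P : Matrix X X ℝ) (π : X → ℝ) : Prop :=
  π ∈ stdSimplex ℝ X ∧ Matrix.vecMul π P = π

/-- Detailed balance: `P` is reversible with respect to `π`. -/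
def IsReversible (P : Matrix X X ℝ) (π : X → ℝ) : Prop :=
  ∀ x y, π x * P x y = π y * P y x

variable (X) in
/-- Transition matrices on `X` that are reversible with respect to an everywhere positive
stationary distribution. -/
def reversibleChains : Set (Matrix X X ℝ) :=
  {P | P ∈ Matrix.rowStochastic ℝ X ∧
    ∃ π : X → ℝ, IsStationary P π ∧ (∀ x, 0 < π x) ∧ IsReversible P π}

/-- The complex eigenvalues of `P`, listed with algebraic multiplicity. -/
def eigenvalues (P : Matrix X X ℝ) : Multiset ℂ :=
  (P.map (algebraMap ℝ ℂ)).charpoly.roots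

/-- The largest modulus of an eigenvalue, after one copy of the eigenvalue `1` is removed
from the list (`0` if nothing remains). -/
def betaStar (P : Matrix X X ℝ) : ℝ :=
  ((((eigenvalues P).erase 1).map (fun z : ℂ => ‖z‖₊)).sup : NNReal)

/-- The relaxation time; used only when `betaStar P < 1`. -/
def tRel (P : Matrix X X ℝ) : ℝ :=
  1 / (1 - betaStar P)

/-- Total variation distance of two probability vectors. -/
def tvDist (μ ν : X → ℝ) : ℝ :=
  (1 / 2) * ∑ x, |μ x - ν x|

/-- The times `t` at which `P ^ t` is, from every starting state, within `ε` of `π`. -/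
def mixedTimes (P : Matrix X X ℝ) (π : X → ℝ) (ε : ℝ) : Set ℕ :=
  {t | ∀ x, tvDist ((P ^ t) x) π ≤ ε}

/-- The mixing time: the least element of `mixedTimes P π ε`. -/
def tMix (P : Matrix X X ℝ) (π : X → ℝ) (ε : ℝ) : ℕ :=
  sInf (mixedTimes P π ε)

end

end MarkovMixing

/-!
If `P` is reversible, then conjugating it by the square roots of the stationary probabilities gives
a symmetric nonnegative matrix. Let `1 = lam 0 ≥ lam 1 ≥ …` be its eigenvalues. By the theorem of
Micchelli and Willoughby the products `∏ k ≤ i, (P - lam i)` are entrywise nonnegative: this holds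
because the entries of `adjugate (X - P)` have nonnegative coefficients in the Newton basis at the
nodes `lam`, which follows by induction on the number of states from the interlacing of the
eigenvalues of principal submatrices.

Divided by `∏ k ≤ i, (1 - lam i)`, these products are stochastic matrices `Λ k` with `Λ N = 1`, with
`P * Λ (k + 1) = lam k • Λ (k + 1) + (1 - lam k) • Λ k`, and with every row of `Λ 1` stationary. So,
when `0 ≤ lam i`, the distance of `P ^ t` from equilibrium is dominated by the tail of a sum of
`N - 1` geometric variables. In the Chernoff bound for that tail, with parameter `c`, every variable
but one costs a factor `c`, since `Λ 1` is exactly at equilibrium; hence the `N - 2` of the theorem.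

The existence of such a `lam` is a closed condition, and since the eigenvalues stay in the compact
interval `[-1, 1]`, it passes to the closure of the reversible chains. Without the sign assumption,
the argument applies to `P ^ 2`.
-/

namespace MarkovMixing

open Polynomial Finset Lagrange Matrix

/-! ### Newton cones -/

section NewtonCone

variable {R : Type*} [CommRing R]

theorem nodal_range_succ (lam : ℕ → R) (k : ℕ) :
    nodal (range (k + 1)) lam = (X - C (lam k)) * nodal (range k) lam := by
  rw [range_add_one, nodal_insert_eq_nodal notMem_range_self]

theorem nodal_Ico_eq_mul (lam : ℕ → R) {k n : ℕ} (hk : k < n) :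
    nodal (Ico k n) lam = (X - C (lam k)) * nodal (Ico (k + 1) n) lam := by
  rw [nodal, prod_eq_prod_Ico_succ_bot hk, nodal]

/-- The Newton polynomials `∏ i < k, (X - lam i)`, a basis of `R[X]`. -/
noncomputable def newtonSequence [Nontrivial R] (lam : ℕ → R) : Polynomial.Sequence R where
  elems' k := nodal (range k) lam
  degree_eq' k := by simp [degree_nodal]

variable [LinearOrder R] [IsStrictOrderedRing R]

/-- The cone of the polynomials whose coefficients in the Newton basis at the nodes `lam` are
nonnegative, and zero beyond degree `m`. -/
noncomputable def newtonCone (lam : ℕ → R) (m : ℕ) : PointedCone R R[X] :=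
  PointedCone.hull R ((fun k => nodal (range k) lam) '' Set.Iic m)

variable {lam mu : ℕ → R} {m : ℕ}

theorem nodal_mem_newtonCone {k : ℕ} (hk : k ≤ m) : nodal (range k) lam ∈ newtonCone lam m :=
  PointedCone.subset_hull (Set.mem_image_of_mem _ hk)

theorem newtonCone_mono (lam : ℕ → R) : Monotone (newtonCone lam) := fun _ _ h =>
  Submodule.span_mono (Set.image_mono (Set.Iic_subset_Iic.2 h))

theorem X_sub_C_mul_mem_newtonCone {a : R} (ha : ∀ k ≤ m, a ≤ lam k) {p : R[X]}
    (hp : p ∈ newtonCone lam m) : (X - C a) * p ∈ newtonCone lam (m + 1) := by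
  induction hp using Submodule.span_induction with
  | mem p hp =>
    obtain ⟨k, hk, rfl⟩ := hp
    have key : (X - C a) * nodal (range k) lam =
        nodal (range (k + 1)) lam + (lam k - a) • nodal (range k) lam := by
      rw [nodal_range_succ, smul_eq_C_mul, C_sub]
      ring
    rw [key]
    exact add_mem (nodal_mem_newtonCone (Nat.succ_le_succ hk))
      (PointedCone.smul_mem _ (sub_nonneg.2 (ha k hk))
        (nodal_mem_newtonCone (Nat.le_succ_of_le hk)))
  | zero => simp
  | add p q _ _ hp hq => rw [mul_add]; exact add_mem hp hq
  | smul c p _ hp => rw [mul_smul_comm]; exact Submodule.smul_mem _ c hp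

theorem newtonCone_le_newtonCone (h : ∀ i < m, ∀ j ≤ i, mu i ≤ lam j) :
    newtonCone mu m ≤ newtonCone lam m := by
  refine Submodule.span_le.2 ?_
  rintro _ ⟨k, hk, rfl⟩
  refine newtonCone_mono lam hk ?_
  induction k with
  | zero => exact nodal_mem_newtonCone (lam := lam) le_rfl
  | succ k ih =>
    beta_reduce
    rw [nodal_range_succ]
    exact X_sub_C_mul_mem_newtonCone (h k hk) (ih (Nat.le_of_succ_le hk))

theorem nonneg_of_sum_mem_newtonCone {c : ℕ → R} {n : ℕ}
    (h : ∑ k ∈ range n, C (c k) * nodal (range k) lam ∈ newtonCone lam m) {k : ℕ} (hk : k < n) :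
    0 ≤ c k := by
  have h_unit (i : ℕ) : IsUnit (newtonSequence lam i).leadingCoeff :=
    (nodal_monic : (nodal (range i) lam).Monic).leadingCoeff ▸ isUnit_one
  set b := (newtonSequence lam).basis h_unit
  have hb (i : ℕ) : b.repr (nodal (range i) lam) = Finsupp.single i 1 := by
    rw [← b.repr_self i]
    exact congrArg b.repr (Polynomial.Sequence.basis_eq_self _ h_unit i).symm
  have hcone {p : R[X]} (hp : p ∈ newtonCone lam m) : 0 ≤ b.repr p k := by
    induction hp using Submodule.span_induction with
    | mem p hp =>
      obtain ⟨i, -, rfl⟩ := hp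
      rw [hb, Finsupp.single_apply]
      split_ifs <;> simp
    | zero => simp
    | add p q _ _ hp hq => simpa using add_nonneg hp hq
    | smul a p _ hp =>
      rw [show a • p = (a : R) • p from rfl, map_smul]
      exact mul_nonneg a.2 hp
  simpa [← smul_eq_C_mul, hb, Finsupp.finsetSum_apply, Finsupp.single_apply, hk] using hcone h

end NewtonCone

/-! ### Adjugates -/

section Adjugate

variable {ι R : Type*} [Fintype ι] [DecidableEq ι] [CommRing R]

theorem adjugate_charmatrix_eq_sum {A : Matrix ι ι R} {lam : ℕ → R} {n : ℕ}
    (hA : A.charpoly = nodal (range n) lam) :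
    adjugate (charmatrix A) = ∑ k ∈ range n,
      nodal (range k) lam • C.mapMatrix (aeval A (nodal (Ico (k + 1) n) lam)) := by
  set φ : Matrix ι ι R →+* Matrix ι ι R[X] := C.mapMatrix
  set T : ℕ → Matrix ι ι R := fun k => aeval A (nodal (Ico k n) lam) with hT
  set u : ℕ → Matrix ι ι R[X] := fun k => nodal (range k) lam • φ (T k) with hu
  have hT_step {k : ℕ} (hk : k < n) : T k = A * T (k + 1) - lam k • T (k + 1) := by
    simp [hT, nodal_Ico_eq_mul lam hk, sub_mul, Algebra.smul_def]
  have h_step (k : ℕ) (hk : k ∈ range n) :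
      charmatrix A * (nodal (range k) lam • φ (T (k + 1))) = u (k + 1) - u k := by
    have hφ : φ (lam k • T (k + 1)) = C (lam k) • φ (T (k + 1)) := by
      ext; simp [φ]
    simp only [hu]
    rw [hT_step (mem_range.1 hk), map_sub, hφ, map_mul, nodal_range_succ, charmatrix,
      scalar_apply, ← smul_one_eq_diagonal]
    simp only [sub_mul, mul_smul_comm, smul_mul_assoc, one_mul, smul_sub, smul_smul]
    module
  have h_prod : charmatrix A * ∑ k ∈ range n, nodal (range k) lam • φ (T (k + 1)) =
      A.charpoly • 1 := by
    have h0 : T 0 = 0 := by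
      rw [hT, ← aeval_self_charpoly A, hA, range_eq_Ico]
    rw [mul_sum, sum_congr rfl h_step, sum_range_sub]
    have hn : T n = 1 := by simp [hT]
    simp [hu, h0, hn, hA]
  have h_adj : A.charpoly • adjugate (charmatrix A) =
      A.charpoly • ∑ k ∈ range n, nodal (range k) lam • φ (T (k + 1)) := by
    calc _ = adjugate (charmatrix A) * (A.charpoly • 1) := by simp
      _ = _ := by rw [← h_prod, ← mul_assoc, adjugate_mul, smul_mul_assoc, one_mul]; rfl
  ext1 x y
  exact A.charpoly_monic.isRegular.left (congrFun₂ h_adj x y)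

/-- The matrix `M` with row and column `x` deleted. -/
abbrev deleteIndex (M : Matrix ι ι R) (x : ι) : Matrix {j // j ≠ x} {j // j ≠ x} R :=
  M.submatrix (↑) (↑)

theorem det_eq_mul_det_deleteIndex_of_row {M : Matrix ι ι R} {x : ι}
    (hM : ∀ j, j ≠ x → M x j = 0) :
    M.det = M x x * (deleteIndex M x).det := by
  rw [twoBlockTriangular_det' M (· = x) (by rintro _ rfl j hj; exact hM j hj)]
  congr 1
  convert det_unique (M.toSquareBlockProp (· = x))
  rfl

theorem adjugate_apply_self_eq_det_deleteIndex (M : Matrix ι ι R) (x : ι) :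
    adjugate M x x = (deleteIndex M x).det := by
  rw [adjugate_apply, det_eq_mul_det_deleteIndex_of_row (x := x) fun j hj => by simp [hj]]
  simp only [updateRow_self, Pi.single_eq_same, one_mul]
  congr 1
  ext i j
  simp [updateRow_ne i.2]

theorem det_updateRow_eq_sum (D : Matrix ι ι R) (w : ι) (b : ι → R) :
    (D.updateRow w b).det = ∑ j, b j * adjugate D j w := by
  rw [← cramer_transpose_apply, cramer_eq_adjugate_mulVec, ← adjugate_transpose]
  simp [mulVec, dotProduct, mul_comm]

theorem adjugate_apply_eq_neg_sum (M : Matrix ι ι R) {x w : ι} (hw : w ≠ x) :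
    adjugate M x w = -∑ j : {j // j ≠ x},
      M x j * adjugate (deleteIndex M x) j ⟨w, hw⟩ := by
  set M' := (M.updateRow w (Pi.single x 1)).submatrix (Equiv.swap x w) id with hM'
  have h_row : M' x = Pi.single x 1 := by ext; simp [hM']
  have h_minor : deleteIndex M' x =
      (deleteIndex M x).updateRow ⟨w, hw⟩ fun j => M x j := by
    ext i j
    obtain rfl | hi := eq_or_ne i ⟨w, hw⟩
    · simp [hM', updateRow_ne hw.symm]
    · have hiw : (i : ι) ≠ w := fun h => hi (Subtype.ext h)
      simp [hM', updateRow_ne hi, updateRow_ne hiw, Equiv.swap_apply_of_ne_of_ne i.2 hiw]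
  have h_det : M'.det = -adjugate M x w := by
    rw [hM', det_permute, Equiv.Perm.sign_swap hw.symm, adjugate_apply]
    simp
  rw [← neg_eq_iff_eq_neg, ← h_det,
    det_eq_mul_det_deleteIndex_of_row (x := x) fun j hj => by simp [h_row, hj],
    h_minor, det_updateRow_eq_sum, h_row, Pi.single_eq_same, one_mul]

end Adjugate

/-! ### Cauchy interlacing -/

section Interlacing

variable {𝕜 E F : Type*} [RCLike 𝕜]
  [NormedAddCommGroup E] [InnerProductSpace 𝕜 E] [FiniteDimensional 𝕜 E]
  [NormedAddCommGroup F] [InnerProductSpace 𝕜 F] [FiniteDimensional 𝕜 F]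
  {T : E →ₗ[𝕜] E} {S : F →ₗ[𝕜] F} {n m : ℕ}

theorem re_inner_apply_self_eq_sum (hT : T.IsSymmetric) (hn : Module.finrank 𝕜 E = n) (v : E) :
    RCLike.re (inner 𝕜 v (T v)) =
      ∑ i, hT.eigenvalues hn i * ‖inner 𝕜 (hT.eigenvectorBasis hn i) v‖ ^ 2 := by
  rw [← (hT.eigenvectorBasis hn).sum_inner_mul_inner v (T v), map_sum]
  refine sum_congr rfl fun i _ => ?_
  rw [← hT, hT.apply_eigenvectorBasis hn i, inner_smul_left, RCLike.conj_ofReal, mul_left_comm,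
    RCLike.re_ofReal_mul, inner_mul_symm_re_eq_norm, norm_mul, norm_inner_symm, sq]

theorem re_inner_apply_self_le (hT : T.IsSymmetric) (hn : Module.finrank 𝕜 E = n) {j : Fin n}
    {v : E} (hv : ∀ k < j, inner 𝕜 (hT.eigenvectorBasis hn k) v = 0) :
    RCLike.re (inner 𝕜 v (T v)) ≤ hT.eigenvalues hn j * ‖v‖ ^ 2 := by
  rw [re_inner_apply_self_eq_sum hT hn, ← (hT.eigenvectorBasis hn).sum_sq_norm_inner_right,
    mul_sum]
  refine sum_le_sum fun l _ => ?_
  rcases le_or_gt j l with hl | hl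
  · exact mul_le_mul_of_nonneg_right (hT.eigenvalues_antitone hn hl) (sq_nonneg _)
  · simp [hv l hl]

theorem le_re_inner_apply_self (hT : T.IsSymmetric) (hn : Module.finrank 𝕜 E = n) {i : Fin n}
    {v : E} (hv : ∀ k, i < k → inner 𝕜 (hT.eigenvectorBasis hn k) v = 0) :
    hT.eigenvalues hn i * ‖v‖ ^ 2 ≤ RCLike.re (inner 𝕜 v (T v)) := by
  rw [re_inner_apply_self_eq_sum hT hn, ← (hT.eigenvectorBasis hn).sum_sq_norm_inner_right,
    mul_sum]
  refine sum_le_sum fun l _ => ?_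
  rcases le_or_gt l i with hl | hl
  · exact mul_le_mul_of_nonneg_right (hT.eigenvalues_antitone hn hl) (sq_nonneg _)
  · simp [hv l hl]

theorem eigenvalues_le_of_isometry (hT : T.IsSymmetric) (hS : S.IsSymmetric)
    (hn : Module.finrank 𝕜 E = n) (hm : Module.finrank 𝕜 F = m) (J : F →ₗᵢ[𝕜] E)
    (hJ : ∀ v, inner 𝕜 (J v) (T (J v)) = inner 𝕜 v (S v)) {i : Fin m} {j : Fin n}
    (hij : (i : ℕ) = j) : hS.eigenvalues hm i ≤ hT.eigenvalues hn j := by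
  let φ : F →ₗ[𝕜] (Iio j → 𝕜) × (Ioi i → 𝕜) :=
    (LinearMap.pi fun k : Iio j => (innerₛₗ 𝕜 (hT.eigenvectorBasis hn k)).comp J.toLinearMap).prod
      (LinearMap.pi fun l : Ioi i => innerₛₗ 𝕜 (hS.eigenvectorBasis hm l))
  have h_ker : LinearMap.ker φ ≠ ⊥ := by
    apply LinearMap.ker_ne_bot_of_finrank_lt
    simp only [Module.finrank_prod, Module.finrank_pi, Fintype.card_coe, Fin.card_Iio,
      Fin.card_Ioi, hm]
    omega
  obtain ⟨v, hv, hv0⟩ := Submodule.exists_mem_ne_zero_of_ne_bot h_ker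
  have hJv : ∀ k < j, inner 𝕜 (hT.eigenvectorBasis hn k) (J v) = 0 := fun k hk =>
    congrFun (congrArg Prod.fst hv) ⟨k, Finset.mem_Iio.2 hk⟩
  have hv' : ∀ l, i < l → inner 𝕜 (hS.eigenvectorBasis hm l) v = 0 := fun l hl =>
    congrFun (congrArg Prod.snd hv) ⟨l, Finset.mem_Ioi.2 hl⟩
  have h_le := (le_re_inner_apply_self hS hm hv').trans
    ((congrArg RCLike.re (hJ v)).symm.trans_le (re_inner_apply_self_le hT hn hJv))
  rw [J.norm_map] at h_le
  exact le_of_mul_le_mul_right h_le (by positivity)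

variable {ι κ : Type*} [Fintype ι] [Fintype κ]

theorem norm_toLp_extend_zero {f : κ → ι} (hf : f.Injective) (v : κ → 𝕜) :
    ‖WithLp.toLp 2 (f.extend v 0)‖ = ‖WithLp.toLp 2 v‖ := by
  simp only [EuclideanSpace.norm_eq]
  congr 1
  refine (Fintype.sum_of_injective f hf _ _ (fun i hi => ?_) fun k => ?_).symm
  · simp [Function.extend_apply' _ _ _ hi]
  · simp [hf.extend_apply]

/-- Extension of vectors by zero along an injective map, as an isometry. -/
noncomputable def extendZeroIsometry (𝕜 : Type*) [RCLike 𝕜] {f : κ → ι} (hf : f.Injective) :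
    EuclideanSpace 𝕜 κ →ₗᵢ[𝕜] EuclideanSpace 𝕜 ι where
  toLinearMap := (WithLp.linearEquiv 2 𝕜 (ι → 𝕜)).symm.toLinearMap ∘ₗ
    Function.ExtendByZero.linearMap 𝕜 f ∘ₗ (WithLp.linearEquiv 2 𝕜 (κ → 𝕜)).toLinearMap
  norm_map' v := norm_toLp_extend_zero hf v.ofLp

theorem extendZeroIsometry_apply {f : κ → ι} (hf : f.Injective) (v : EuclideanSpace 𝕜 κ) :
    extendZeroIsometry 𝕜 hf v = WithLp.toLp 2 (f.extend v.ofLp 0) :=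
  rfl

variable [DecidableEq ι] [DecidableEq κ]

theorem eigenvalues₀_submatrix_le {A : Matrix ι ι 𝕜} (hA : A.IsHermitian) {f : κ → ι}
    (hf : f.Injective) (i : Fin (Fintype.card κ)) :
    (hA.submatrix f).eigenvalues₀ i ≤
      hA.eigenvalues₀ (i.castLE (Fintype.card_le_of_injective f hf)) := by
  refine eigenvalues_le_of_isometry _ _ _ _ (extendZeroIsometry 𝕜 hf) (fun v => ?_) rfl
  have h_ext (k : κ) : f.extend v.ofLp 0 (f k) = v k := hf.extend_apply _ _ k
  have h_ext' (k : ι) (hk : k ∉ Set.range f) : f.extend v.ofLp 0 k = 0 :=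
    Function.extend_apply' _ _ _ hk
  have h_mulVec (k : κ) :
      (A.submatrix f f *ᵥ v.ofLp) k = (A *ᵥ f.extend v.ofLp 0) (f k) := by
    refine Fintype.sum_of_injective f hf _ _ (fun l hl => ?_) fun l => ?_
    · simp [h_ext' l hl]
    · simp [h_ext]
  refine (Fintype.sum_of_injective f hf _ _ (fun k hk => ?_) fun k => ?_).symm
  · simp [extendZeroIsometry_apply, h_ext' k hk]
  · simp [extendZeroIsometry_apply, h_ext, h_mulVec, toLpLin_apply]

/-- The eigenvalues of a Hermitian matrix in decreasing order, listed with multiplicity; `0` from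
the index `Fintype.card ι` on. -/
noncomputable def sortedEigenvalues {A : Matrix ι ι 𝕜} (hA : A.IsHermitian) (i : ℕ) : ℝ :=
  if h : i < Fintype.card ι then hA.eigenvalues₀ ⟨i, h⟩ else 0

theorem sortedEigenvalues_of_lt {A : Matrix ι ι 𝕜} (hA : A.IsHermitian) {i : ℕ}
    (hi : i < Fintype.card ι) : sortedEigenvalues hA i = hA.eigenvalues₀ ⟨i, hi⟩ :=
  dif_pos hi

theorem sortedEigenvalues_antitoneOn {A : Matrix ι ι 𝕜} (hA : A.IsHermitian) :
    AntitoneOn (sortedEigenvalues hA) (Set.Iio (Fintype.card ι)) := by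
  intro i hi j hj hij
  rw [sortedEigenvalues_of_lt hA hi, sortedEigenvalues_of_lt hA hj]
  exact hA.eigenvalues₀_antitone hij

theorem sortedEigenvalues_submatrix_le {A : Matrix ι ι 𝕜} (hA : A.IsHermitian) {f : κ → ι}
    (hf : f.Injective) {i : ℕ} (hi : i < Fintype.card κ) :
    sortedEigenvalues (hA.submatrix f) i ≤ sortedEigenvalues hA i := by
  rw [sortedEigenvalues_of_lt _ hi,
    sortedEigenvalues_of_lt _ (hi.trans_le (Fintype.card_le_of_injective f hf))]
  exact eigenvalues₀_submatrix_le hA hf ⟨i, hi⟩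

theorem charpoly_eq_nodal_sortedEigenvalues {A : Matrix ι ι ℝ} (hA : A.IsHermitian) :
    A.charpoly = nodal (range (Fintype.card ι)) (sortedEigenvalues hA) := by
  rw [hA.splits_charpoly.eq_prod_roots_of_monic A.charpoly_monic,
    hA.roots_charpoly_eq_eigenvalues₀, Multiset.map_map, nodal, Finset.prod_range]
  simp only [sortedEigenvalues_of_lt hA (Fin.is_lt _)]
  rfl

end Interlacing

/-! ### The Micchelli–Willoughby theorem -/

section MicchelliWilloughby

variable {ι : Type*} [Fintype ι] [DecidableEq ι]

theorem charmatrix_submatrix {κ R : Type*} [Fintype κ] [DecidableEq κ] [CommRing R]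
    (A : Matrix ι ι R) {f : κ → ι} (hf : f.Injective) :
    (charmatrix A).submatrix f f = charmatrix (A.submatrix f f) := by
  ext i j : 2
  obtain rfl | h := eq_or_ne i j
  · simp
  · simp [charmatrix_apply_ne _ _ _ h, charmatrix_apply_ne _ _ _ (hf.ne h)]

theorem adjugate_charmatrix_mem_newtonCone {A : Matrix ι ι ℝ} (hA : A.IsHermitian)
    (hA_nonneg : ∀ x y, 0 ≤ A x y) (x y : ι) :
    adjugate (charmatrix A) x y ∈ newtonCone (sortedEigenvalues hA) (Fintype.card ι) := by
  induction hn : Fintype.card ι generalizing ι with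
  | zero => exact (Fintype.card_eq_zero_iff.1 hn).elim x
  | succ n ih =>
    have hB : (deleteIndex A x).IsHermitian := hA.submatrix _
    have h_card : Fintype.card {j // j ≠ x} = n := by simp [Fintype.card_subtype_compl, hn]
    have h_charmatrix : deleteIndex (charmatrix A) x = charmatrix (deleteIndex A x) :=
      charmatrix_submatrix A Subtype.val_injective
    have h_cone : newtonCone (sortedEigenvalues hB) n ≤
        newtonCone (sortedEigenvalues hA) (n + 1) := by
      refine (newtonCone_le_newtonCone fun i hi j hji => ?_).trans
        (newtonCone_mono _ (Nat.le_succ n))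
      exact (sortedEigenvalues_submatrix_le hA Subtype.val_injective (h_card ▸ hi)).trans
        (sortedEigenvalues_antitoneOn hA (Set.mem_Iio.2 (by omega)) (Set.mem_Iio.2 (by omega)) hji)
    obtain rfl | hyx := eq_or_ne y x
    · rw [adjugate_apply_self_eq_det_deleteIndex, h_charmatrix]
      refine h_cone ?_
      rw [← Matrix.charpoly, charpoly_eq_nodal_sortedEigenvalues hB, h_card]
      exact nodal_mem_newtonCone le_rfl
    · rw [adjugate_apply_eq_neg_sum _ hyx, h_charmatrix, ← sum_neg_distrib]
      refine sum_mem fun j _ => ?_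
      rw [charmatrix_apply_ne _ _ _ j.2.symm, neg_mul, neg_neg, ← smul_eq_C_mul]
      exact PointedCone.smul_mem _ (hA_nonneg x j)
        (h_cone (ih hB (fun _ _ => hA_nonneg _ _) j _ h_card))

theorem aeval_nodal_sortedEigenvalues_nonneg {A : Matrix ι ι ℝ} (hA : A.IsHermitian)
    (hA_nonneg : ∀ x y, 0 ≤ A x y) {k : ℕ} (hk : k < Fintype.card ι) (x y : ι) :
    0 ≤ aeval A (nodal (Ico (k + 1) (Fintype.card ι)) (sortedEigenvalues hA)) x y := by
  have h_mem := adjugate_charmatrix_mem_newtonCone hA hA_nonneg x y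
  rw [adjugate_charmatrix_eq_sum (charpoly_eq_nodal_sortedEigenvalues hA), Matrix.sum_apply]
    at h_mem
  refine nonneg_of_sum_mem_newtonCone (m := Fintype.card ι) (lam := sortedEigenvalues hA)
    (c := fun k => aeval A (nodal (Ico (k + 1) _) (sortedEigenvalues hA)) x y) ?_ hk
  simpa [mul_comm] using h_mem

end MicchelliWilloughby

/-! ### The closure of the reversible chains -/

section Topology

variable {R A : Type*} [CommRing R] [TopologicalSpace R] [Ring A] [Algebra R A]
  [TopologicalSpace A] [IsTopologicalRing A] [ContinuousSMul R A]

theorem continuous_aeval_nodal (s : Finset ℕ) :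
    Continuous fun q : (ℕ → R) × A => aeval q.2 (nodal s q.1) := by
  induction s using Finset.induction_on with
  | empty => simpa only [nodal_empty, map_one] using continuous_const
  | insert i s hi ih =>
    simp only [nodal_insert_eq_nodal hi, map_mul, map_sub, aeval_X, aeval_C,
      Algebra.algebraMap_eq_smul_one]
    fun_prop

end Topology

section Spectrum

variable {X : Type*} [Fintype X] [DecidableEq X] {P : Matrix X X ℝ} {lam mu : ℕ → ℝ}

/-- `lam` lists the eigenvalues of `P` in decreasing order, and the products of the factors
`P - lam i` over the smallest eigenvalues are entrywise nonnegative: the spectral information that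
the Micchelli–Willoughby theorem gives about a symmetric nonnegative matrix. Only the entries
`lam i` with `i < Fintype.card X` matter. -/
structure IsMWSpectrum (P : Matrix X X ℝ) (lam : ℕ → ℝ) : Prop where
  antitoneOn : AntitoneOn lam (Set.Iio (Fintype.card X))
  charpoly_eq : P.charpoly = nodal (range (Fintype.card X)) lam
  aeval_nodal_nonneg : ∀ k < Fintype.card X, ∀ x y,
    0 ≤ aeval P (nodal (Ico (k + 1) (Fintype.card X)) lam) x y

theorem isMWSpectrum_sortedEigenvalues (hP : P.IsHermitian) (hP_nonneg : ∀ x y, 0 ≤ P x y) :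
    IsMWSpectrum P (sortedEigenvalues hP) where
  antitoneOn := sortedEigenvalues_antitoneOn hP
  charpoly_eq := charpoly_eq_nodal_sortedEigenvalues hP
  aeval_nodal_nonneg _ hk := aeval_nodal_sortedEigenvalues_nonneg hP hP_nonneg hk

theorem IsMWSpectrum.congr (h : IsMWSpectrum P lam) (hlam : ∀ i < Fintype.card X, lam i = mu i) :
    IsMWSpectrum P mu where
  antitoneOn := h.antitoneOn.congr fun i hi => hlam i hi
  charpoly_eq := h.charpoly_eq.trans <|
    prod_congr rfl fun i hi => by rw [hlam i (mem_range.1 hi)]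
  aeval_nodal_nonneg k hk := by
    have h_nodal : nodal (Ico (k + 1) (Fintype.card X)) mu =
        nodal (Ico (k + 1) (Fintype.card X)) lam :=
      prod_congr rfl fun i hi => by rw [hlam i (Finset.mem_Ico.1 hi).2]
    exact h_nodal ▸ h.aeval_nodal_nonneg k hk

theorem exists_units_conj_apply {K : Type*} [Field K] {s : X → K} (hs : ∀ x, s x ≠ 0) :
    ∃ U : (Matrix X X K)ˣ, ∀ (M : Matrix X X K) x y,
      (U.val * M * U⁻¹.val) x y = s x * M x y * (s y)⁻¹ := by
  have h_mul : diagonal s * diagonal s⁻¹ = 1 := by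
    simp [diagonal_mul_diagonal, hs, ← diagonal_one]
  refine ⟨⟨diagonal s, diagonal s⁻¹, h_mul, mul_eq_one_comm.1 h_mul⟩, fun M x y => ?_⟩
  simp [mul_diagonal, diagonal_mul]

theorem IsMWSpectrum.of_units_conj {U : (Matrix X X ℝ)ˣ} {s : X → ℝ} (hs : ∀ x, 0 < s x)
    (hU : ∀ (M : Matrix X X ℝ) x y, (U.val * M * U⁻¹.val) x y = s x * M x y * (s y)⁻¹)
    (h : IsMWSpectrum (U.val * P * U⁻¹.val) lam) : IsMWSpectrum P lam where
  antitoneOn := h.antitoneOn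
  charpoly_eq := by rw [← h.charpoly_eq, coe_units_inv, charpoly_units_conj]
  aeval_nodal_nonneg k hk x y := by
    have h_conj (p : ℝ[X]) : aeval (U.val * P * U⁻¹.val) p = U.val * aeval P p * U⁻¹.val := by
      simpa only [ConjAct.units_smul_def, ConjAct.ofConjAct_toConjAct] using
        aeval_smul p (ConjAct.toConjAct U) P
    have h_nonneg := h.aeval_nodal_nonneg k hk x y
    rwa [h_conj, hU, mul_nonneg_iff_of_pos_right (inv_pos.2 (hs y)),
      mul_nonneg_iff_of_pos_left (hs x)] at h_nonneg

theorem IsReversible.exists_isMWSpectrum {π : X → ℝ} (hP : IsReversible P π)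
    (hP_nonneg : ∀ x y, 0 ≤ P x y) (hπ : ∀ x, 0 < π x) : ∃ lam, IsMWSpectrum P lam := by
  have hs (x : X) : 0 < √(π x) := Real.sqrt_pos.2 (hπ x)
  obtain ⟨U, hU⟩ := exists_units_conj_apply fun x => (hs x).ne'
  have h_symm : (U.val * P * U⁻¹.val).IsHermitian := by
    ext x y
    rw [conjTranspose_apply, star_trivial, hU, hU, ← div_eq_mul_inv, ← div_eq_mul_inv,
      div_eq_div_iff (hs _).ne' (hs _).ne']
    linear_combination P y x * Real.mul_self_sqrt (hπ y).le - hP x y -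
      P x y * Real.mul_self_sqrt (hπ x).le
  have h_nonneg (x y : X) : 0 ≤ (U.val * P * U⁻¹.val) x y := by
    rw [hU]
    exact mul_nonneg (mul_nonneg (hs x).le (hP_nonneg x y)) (inv_nonneg.2 (hs y).le)
  exact ⟨_, (isMWSpectrum_sortedEigenvalues h_symm h_nonneg).of_units_conj hs hU⟩

theorem isClosed_setOf_isMWSpectrum :
    IsClosed {q : (ℕ → ℝ) × Matrix X X ℝ | IsMWSpectrum q.2 q.1} := by
  have h_eq : {q : (ℕ → ℝ) × Matrix X X ℝ | IsMWSpectrum q.2 q.1} =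
      {q : (ℕ → ℝ) × Matrix X X ℝ |
        (∀ i < Fintype.card X, ∀ j < Fintype.card X, i ≤ j → q.1 j ≤ q.1 i) ∧
        (∀ z : ℝ, (scalar X z - q.2).det = ∏ i ∈ range (Fintype.card X), (z - q.1 i)) ∧
        ∀ k < Fintype.card X, ∀ x y,
          0 ≤ aeval q.2 (nodal (Ico (k + 1) (Fintype.card X)) q.1) x y} := by
    ext q
    have h_charpoly : q.2.charpoly = nodal (range (Fintype.card X)) q.1 ↔
        ∀ z : ℝ, (scalar X z - q.2).det = ∏ i ∈ range (Fintype.card X), (z - q.1 i) := by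
      simp only [← eval_charpoly, ← eval_nodal]
      exact ⟨fun h z => by rw [h], Polynomial.funext⟩
    exact ⟨fun h => ⟨fun i hi j hj => h.antitoneOn hi hj, h_charpoly.1 h.charpoly_eq,
        h.aeval_nodal_nonneg⟩,
      fun h => ⟨fun i hi j hj => h.1 i hi j hj, h_charpoly.2 h.2.1, h.2.2⟩⟩
  rw [h_eq]
  simp only [Set.ofPred_and, Set.ofPred_forall]
  refine IsClosed.inter ?_ (IsClosed.inter ?_ ?_)
  · refine isClosed_iInter fun i => isClosed_iInter fun _ => isClosed_iInter fun j =>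
      isClosed_iInter fun _ => isClosed_iInter fun _ => isClosed_le ?_ ?_ <;> fun_prop
  · refine isClosed_iInter fun z => isClosed_eq (Continuous.matrix_det ?_) ?_
    · exact continuous_const.sub continuous_snd
    · fun_prop
  · refine isClosed_iInter fun k => isClosed_iInter fun _ => isClosed_iInter fun x =>
      isClosed_iInter fun y => isClosed_le continuous_const ?_
    exact (continuous_aeval_nodal _).matrix_elem x y

theorem isClosed_rowStochastic : IsClosed (rowStochastic ℝ X : Set (Matrix X X ℝ)) := by
  have h_eq : (rowStochastic ℝ X : Set (Matrix X X ℝ)) =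
      {M | (∀ x y, 0 ≤ M x y) ∧ ∀ x, ∑ y, M x y = 1} := by
    ext
    exact mem_rowStochastic_iff_sum
  rw [h_eq]
  simp only [Set.ofPred_and, Set.ofPred_forall]
  refine IsClosed.inter ?_ ?_
  · exact isClosed_iInter fun x => isClosed_iInter fun y =>
      isClosed_le continuous_const (continuous_id.matrix_elem x y)
  · exact isClosed_iInter fun x => isClosed_eq
      (continuous_finsetSum _ fun y _ => continuous_id.matrix_elem x y) continuous_const

theorem mem_Icc_of_isRoot_charpoly (hP : P ∈ rowStochastic ℝ X) {z : ℝ}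
    (hz : P.charpoly.IsRoot z) : z ∈ Set.Icc (-1 : ℝ) 1 := by
  rw [← charpoly_toLin', ← Module.End.hasEigenvalue_iff_isRoot_charpoly] at hz
  obtain ⟨k, hk⟩ := eigenvalue_mem_ball hz
  have h_nonneg (j : X) : 0 ≤ P k j := nonneg_of_mem_rowStochastic hP
  have h_sum := sum_row_of_mem_rowStochastic hP k
  rw [← add_sum_erase _ _ (mem_univ k)] at h_sum
  simp only [Real.norm_of_nonneg (h_nonneg _), Metric.mem_closedBall, Real.dist_eq, abs_le] at hk
  constructor <;> linarith [h_nonneg k]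

theorem IsMWSpectrum.mem_Icc (h : IsMWSpectrum P lam) (hP : P ∈ rowStochastic ℝ X) {i : ℕ}
    (hi : i < Fintype.card X) : lam i ∈ Set.Icc (-1 : ℝ) 1 :=
  mem_Icc_of_isRoot_charpoly hP <| h.charpoly_eq ▸ eval_nodal_at_node (Finset.mem_range.2 hi)

theorem IsMWSpectrum.exists_Icc (h : IsMWSpectrum P lam) (hP : P ∈ rowStochastic ℝ X) :
    ∃ mu : ℕ → Set.Icc (-1 : ℝ) 1, IsMWSpectrum P fun i => mu i :=
  ⟨fun i => Set.projIcc (-1) 1 (by norm_num) (lam i),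
    h.congr fun i hi => by
      beta_reduce
      rw [Set.projIcc_of_mem _ (h.mem_Icc hP hi)]⟩

theorem exists_isMWSpectrum_of_mem_closure (hP : P ∈ closure (reversibleChains X)) :
    ∃ lam, IsMWSpectrum P lam := by
  let Q : Set (Matrix X X ℝ) := {P | ∃ lam : ℕ → Set.Icc (-1 : ℝ) 1, IsMWSpectrum P fun i => lam i}
  have hQ : IsClosed Q := by
    have h_closed : IsClosed {q : (ℕ → Set.Icc (-1 : ℝ) 1) × Matrix X X ℝ |
        IsMWSpectrum q.2 fun i => q.1 i} :=
      isClosed_setOf_isMWSpectrum.preimage (f := fun q : (ℕ → Set.Icc (-1 : ℝ) 1) × Matrix X X ℝ =>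
        (fun i => (q.1 i : ℝ), q.2)) (by fun_prop)
    convert isClosedMap_snd_of_compactSpace _ h_closed
    ext P
    simp [Q]
  have h_sub : reversibleChains X ⊆ Q := by
    rintro P ⟨hP, π, -, hπ, h_rev⟩
    obtain ⟨lam, hlam⟩ :=
      h_rev.exists_isMWSpectrum (fun _ _ => nonneg_of_mem_rowStochastic hP) hπ
    exact hlam.exists_Icc hP
  obtain ⟨lam, hlam⟩ := closure_minimal h_sub hQ hP
  exact ⟨_, hlam⟩

theorem mem_rowStochastic_of_mem_closure (hP : P ∈ closure (reversibleChains X)) :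
    P ∈ rowStochastic ℝ X :=
  closure_minimal (fun _ h => h.1) isClosed_rowStochastic hP

theorem sq_mem_reversibleChains (hP : P ∈ reversibleChains X) : P ^ 2 ∈ reversibleChains X := by
  obtain ⟨hP, π, ⟨hπ, hπP⟩, hπ_pos, h_rev⟩ := hP
  refine ⟨pow_mem hP 2, π, ⟨hπ, ?_⟩, hπ_pos, fun x y => ?_⟩
  · rw [sq, ← vecMul_vecMul, hπP, hπP]
  · rw [sq, mul_apply, mul_apply, mul_sum, mul_sum]
    refine sum_congr rfl fun z _ => ?_
    linear_combination P z y * h_rev x z + P z x * h_rev z y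

theorem sq_mem_closure_reversibleChains (hP : P ∈ closure (reversibleChains X)) :
    P ^ 2 ∈ closure (reversibleChains X) :=
  map_mem_closure (f := (· ^ 2)) (continuous_pow 2) hP fun _ => sq_mem_reversibleChains

end Spectrum

/-! ### Eigenvalues of a chain -/

section Eigenvalues

variable {X : Type*} [Fintype X] [DecidableEq X] {P : Matrix X X ℝ} {lam : ℕ → ℝ}

theorem roots_charpoly_sq {K : Type*} [Field K] [IsAlgClosed K] (M : Matrix X X K) :
    (M ^ 2).charpoly.roots = M.charpoly.roots.map (· ^ 2) := by
  have h_eval (z : K) : (scalar X z - M).det = (M.charpoly.roots.map (z - ·)).prod := by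
    rw [← eval_charpoly,
      (IsAlgClosed.splits _).eval_eq_prod_roots_of_monic (charpoly_monic M)]
  have h_neg (z : K) : (scalar X z + M).det = (M.charpoly.roots.map (z + ·)).prod := by
    have h_card : M.charpoly.roots.card = Fintype.card X := by
      rw [← (IsAlgClosed.splits _).natDegree_eq_card_roots, charpoly_natDegree_eq_dim]
    have h_matrix : scalar X z + M = -(scalar X (-z) - M) := by
      rw [map_neg, neg_sub, sub_neg_eq_add, add_comm]
    rw [h_matrix, det_neg, h_eval, ← h_card, ← Multiset.card_map (-z - ·),
      ← Multiset.prod_map_neg, Multiset.map_map]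
    simp only [Function.comp_def, neg_sub, sub_neg_eq_add, add_comm]
  have h_charpoly : (M ^ 2).charpoly =
      ((M.charpoly.roots.map (· ^ 2)).map (Polynomial.X - C ·)).prod := by
    refine Polynomial.funext fun w => ?_
    obtain ⟨z, rfl⟩ := IsAlgClosed.exists_pow_nat_eq w two_pos
    have h_comm : Commute (scalar X z) M := scalar_commute z (fun _ => Commute.all _ _) M
    rw [eval_charpoly, map_pow, h_comm.sq_sub_sq, det_mul, h_neg, h_eval, ← Multiset.prod_map_mul,
      eval_multiset_prod, Multiset.map_map, Multiset.map_map]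
    simp only [Function.comp_def, eval_sub, eval_X, eval_C, sq_sub_sq]
  rw [h_charpoly, roots_multiset_prod_X_sub_C]

theorem eigenvalues_sq (P : Matrix X X ℝ) : eigenvalues (P ^ 2) = (eigenvalues P).map (· ^ 2) := by
  rw [eigenvalues, Matrix.map_pow, roots_charpoly_sq, eigenvalues]

theorem norm_le_betaStar {z : ℂ} (hz : z ∈ (eigenvalues P).erase 1) : ‖z‖ ≤ betaStar P :=
  NNReal.coe_le_coe.2 <| Multiset.le_sup <| Multiset.mem_map_of_mem (fun z : ℂ => ‖z‖₊) hz

theorem betaStar_le {β : ℝ} (hβ : 0 ≤ β) (h : ∀ z ∈ (eigenvalues P).erase 1, ‖z‖ ≤ β) :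
    betaStar P ≤ β := by
  lift β to NNReal using hβ
  refine NNReal.coe_le_coe.2 <| Multiset.sup_le.2 fun r hr => ?_
  obtain ⟨z, hz, rfl⟩ := Multiset.mem_map.1 hr
  exact h z hz

theorem betaStar_nonneg (P : Matrix X X ℝ) : 0 ≤ betaStar P :=
  NNReal.coe_nonneg _

theorem isRoot_charpoly_one [Nonempty X] (hP : P ∈ rowStochastic ℝ X) : P.charpoly.IsRoot 1 := by
  rw [← charpoly_toLin', ← Module.End.hasEigenvalue_iff_isRoot_charpoly]
  refine Module.End.hasEigenvalue_of_hasEigenvector (x := (1 : X → ℝ))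
    ⟨Module.End.mem_eigenspace_iff.2 ?_, one_ne_zero⟩
  rw [toLin'_apply, one_vecMul_of_mem_rowStochastic hP, one_smul]

theorem one_mem_eigenvalues [Nonempty X] (hP : P ∈ rowStochastic ℝ X) : 1 ∈ eigenvalues P := by
  rw [eigenvalues, mem_roots (charpoly_monic _).ne_zero, charpoly_map]
  simpa only [map_one] using (isRoot_charpoly_one hP).map (f := algebraMap ℝ ℂ)

theorem betaStar_sq_le [Nonempty X] (hP : P ∈ rowStochastic ℝ X) :
    betaStar (P ^ 2) ≤ betaStar P ^ 2 := by
  have h_erase : (eigenvalues (P ^ 2)).erase 1 = ((eigenvalues P).erase 1).map (· ^ 2) := by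
    rw [eigenvalues_sq, Multiset.map_erase_of_mem _ _ (one_mem_eigenvalues hP), one_pow]
  refine betaStar_le (sq_nonneg _) fun w hw => ?_
  obtain ⟨z, hz, rfl⟩ := Multiset.mem_map.1 (h_erase ▸ hw)
  rw [norm_pow]
  exact pow_le_pow_left₀ (norm_nonneg z) (norm_le_betaStar hz) 2

theorem rootMultiplicity_one_le_one (hβ : betaStar P < 1) :
    P.charpoly.rootMultiplicity 1 ≤ 1 := by
  have h_erase : (1 : ℂ) ∉ (eigenvalues P).erase 1 := fun h =>
    (norm_le_betaStar h).not_gt (by rwa [norm_one])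
  rw [eq_rootMultiplicity_map (algebraMap ℝ ℂ).injective, map_one, ← charpoly_map, ← count_roots]
  rw [← Multiset.count_eq_zero, Multiset.count_erase_self, eigenvalues] at h_erase
  omega

namespace IsMWSpectrum

theorem eigenvalues_eq_map (h : IsMWSpectrum P lam) :
    eigenvalues P = (range (Fintype.card X)).val.map fun i => (lam i : ℂ) := by
  rw [eigenvalues, charpoly_map, h.charpoly_eq, nodal, Polynomial.map_prod]
  simp only [Polynomial.map_sub, map_X, map_C]
  rw [← roots_multiset_prod_X_sub_C (Multiset.map _ _), Multiset.map_map]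
  rfl

theorem apply_zero [Nonempty X] (h : IsMWSpectrum P lam) (hP : P ∈ rowStochastic ℝ X) :
    lam 0 = 1 := by
  have h_root := isRoot_charpoly_one hP
  rw [h.charpoly_eq, IsRoot, eval_nodal, prod_eq_zero_iff] at h_root
  obtain ⟨i, hi, hi_eq⟩ := h_root
  refine le_antisymm (h.mem_Icc hP Fintype.card_pos).2 ?_
  rw [sub_eq_zero.1 hi_eq]
  exact h.antitoneOn Fintype.card_pos (mem_range.1 hi) (Nat.zero_le i)

theorem ofReal_mem_erase_eigenvalues [Nonempty X] (h : IsMWSpectrum P lam)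
    (hP : P ∈ rowStochastic ℝ X) {i : ℕ} (hi : i ∈ Ico 1 (Fintype.card X)) :
    (lam i : ℂ) ∈ (eigenvalues P).erase 1 := by
  have h_cons : eigenvalues P =
      1 ::ₘ (Ico 1 (Fintype.card X)).val.map fun i => (lam i : ℂ) := by
    rw [h.eigenvalues_eq_map, range_eq_Ico, ← insert_Ico_succ_left_eq_Ico Fintype.card_pos,
      insert_val_of_notMem (by simp), Multiset.map_cons, h.apply_zero hP, Complex.ofReal_one]
    rfl
  rw [h_cons, Multiset.erase_cons_head]
  exact Multiset.mem_map_of_mem (fun i => (lam i : ℂ)) hi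

theorem abs_apply_le_betaStar [Nonempty X] (h : IsMWSpectrum P lam)
    (hP : P ∈ rowStochastic ℝ X) {i : ℕ} (hi : i ∈ Ico 1 (Fintype.card X)) :
    |lam i| ≤ betaStar P := by
  simpa only [Complex.norm_real, Real.norm_eq_abs] using
    norm_le_betaStar (h.ofReal_mem_erase_eigenvalues hP hi)

end IsMWSpectrum

end Eigenvalues

/-! ### Stationary distributions and local equilibria -/

section LocalEquilibria

variable {X : Type*} [Fintype X] [DecidableEq X] {P : Matrix X X ℝ} {lam : ℕ → ℝ}

theorem isStationary_apply_of_mul_eq {T : Matrix X X ℝ} (hT : T ∈ rowStochastic ℝ X)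
    (hTP : T * P = T) (x : X) : IsStationary P (T x) :=
  ⟨⟨fun _ => nonneg_of_mem_rowStochastic hT, sum_row_of_mem_rowStochastic hT x⟩,
    congrFun hTP x⟩

theorem IsStationary.eq_of_rootMultiplicity_le_one (hP : P.charpoly.rootMultiplicity 1 ≤ 1)
    {π π' : X → ℝ} (hπ : IsStationary P π) (hπ' : IsStationary P π') : π = π' := by
  have h_mem {μ : X → ℝ} (hμ : IsStationary P μ) : μ ∈ Module.End.eigenspace (toLin' Pᵀ) 1 := by
    rw [Module.End.mem_eigenspace_iff, toLin'_apply, mulVec_transpose, hμ.2, one_smul]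
  have h_finrank := LinearMap.finrank_eigenspace_le (toLin' Pᵀ) 1
  rw [charpoly_toLin', charpoly_transpose] at h_finrank
  obtain ⟨v, hv⟩ := finrank_le_one_iff.1 (h_finrank.trans hP)
  have h_scale {μ : X → ℝ} (hμ : IsStationary P μ) : ∃ a : ℝ, a • (v : X → ℝ) = μ :=
    (hv ⟨μ, h_mem hμ⟩).imp fun _ h => congrArg Subtype.val h
  obtain ⟨⟨a, rfl⟩, b, rfl⟩ := h_scale hπ, h_scale hπ'
  have h_sum : a * ∑ x, (v : X → ℝ) x = b * ∑ x, (v : X → ℝ) x := by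
    rw [mul_sum, mul_sum]
    exact hπ.1.2.trans hπ'.1.2.symm
  have h_ne : ∑ x, (v : X → ℝ) x ≠ 0 := fun h => by
    have h_one : a * ∑ x, (v : X → ℝ) x = 1 := by
      rw [mul_sum]
      exact hπ.1.2
    simp [h] at h_one
  rw [mul_right_cancel₀ h_ne h_sum]

theorem IsStationary.sq {π : X → ℝ} (hπ : IsStationary P π) : IsStationary (P ^ 2) π :=
  ⟨hπ.1, by rw [pow_two, ← vecMul_vecMul, hπ.2, hπ.2]⟩

theorem aeval_mulVec_eq_eval_smul {K : Type*} [Field K] {M : Matrix X X K} {a : K} {f : X → K}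
    (hf : M *ᵥ f = a • f) (p : K[X]) : aeval M p *ᵥ f = p.eval a • f := by
  have h_aeval : aeval (toLin' M) p = toLin' (aeval M p) := aeval_algHom_apply toLinAlgEquiv' M p
  rw [← toLin'_apply, ← h_aeval]
  exact Module.End.aeval_apply_of_mem_apply_eq_smul hf

/-- The Micchelli–Willoughby local equilibria `∏ k ≤ i, (P - lam i) / (1 - lam i)`, indexed by the
number `k` of the largest eigenvalues left out. They interpolate between the identity at
`k = Fintype.card X` and the projection onto equilibrium at `k = 1`. -/
noncomputable def localEquilibrium (P : Matrix X X ℝ) (lam : ℕ → ℝ) (k : ℕ) : Matrix X X ℝ :=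
  (∏ i ∈ Ico k (Fintype.card X), (1 - lam i))⁻¹ • aeval P (nodal (Ico k (Fintype.card X)) lam)

theorem localEquilibrium_card (P : Matrix X X ℝ) (lam : ℕ → ℝ) :
    localEquilibrium P lam (Fintype.card X) = 1 := by
  simp [localEquilibrium]

theorem mul_localEquilibrium_succ {k : ℕ} (hk : k < Fintype.card X) (hlam : lam k ≠ 1) :
    P * localEquilibrium P lam (k + 1) =
      lam k • localEquilibrium P lam (k + 1) + (1 - lam k) • localEquilibrium P lam k := by
  have h_ne : 1 - lam k ≠ 0 := sub_ne_zero.2 hlam.symm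
  rw [localEquilibrium, localEquilibrium, nodal_Ico_eq_mul lam hk, prod_eq_prod_Ico_succ_bot hk,
    mul_inv, ← smul_smul, smul_inv_smul₀ h_ne, map_mul, map_sub, aeval_X, aeval_C,
    Algebra.algebraMap_eq_smul_one, sub_mul, smul_mul_assoc, one_mul, mul_smul_comm]
  module

theorem pow_succ_mul_localEquilibrium_succ {k : ℕ} (hk : k < Fintype.card X) (hlam : lam k ≠ 1)
    (t : ℕ) : P ^ (t + 1) * localEquilibrium P lam (k + 1) =
      lam k • (P ^ t * localEquilibrium P lam (k + 1)) +
        (1 - lam k) • (P ^ t * localEquilibrium P lam k) := by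
  rw [pow_succ, mul_assoc, mul_localEquilibrium_succ hk hlam, mul_add, mul_smul_comm,
    mul_smul_comm]

theorem commute_localEquilibrium (P : Matrix X X ℝ) (lam : ℕ → ℝ) (k : ℕ) :
    Commute P (localEquilibrium P lam k) :=
  Commute.smul_right (by simpa only [aeval_X] using
    (Commute.all Polynomial.X (nodal (Ico k (Fintype.card X)) lam)).map (aeval (R := ℝ) P)) _

namespace IsMWSpectrum

theorem localEquilibrium_mem_rowStochastic (h : IsMWSpectrum P lam) (hP : P ∈ rowStochastic ℝ X)
    {k : ℕ} (hk : k < Fintype.card X) (hlam : ∀ i ∈ Ico (k + 1) (Fintype.card X), lam i < 1) :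
    localEquilibrium P lam (k + 1) ∈ rowStochastic ℝ X := by
  have h_pos : 0 < ∏ i ∈ Ico (k + 1) (Fintype.card X), (1 - lam i) :=
    prod_pos fun i hi => sub_pos.2 (hlam i hi)
  refine mem_rowStochastic.2 ⟨fun x y => ?_, ?_⟩
  · exact mul_nonneg (inv_nonneg.2 h_pos.le) (h.aeval_nodal_nonneg k hk x y)
  · have h_one : P *ᵥ 1 = (1 : ℝ) • (1 : X → ℝ) := by
      rw [one_vecMul_of_mem_rowStochastic hP, one_smul]
    rw [localEquilibrium, smul_mulVec, aeval_mulVec_eq_eval_smul h_one, eval_nodal,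
      inv_smul_smul₀ h_pos.ne']

theorem mul_localEquilibrium_one [Nonempty X] (h : IsMWSpectrum P lam)
    (hP : P ∈ rowStochastic ℝ X) : P * localEquilibrium P lam 1 = localEquilibrium P lam 1 := by
  have h_zero : aeval P (nodal (Ico 0 (Fintype.card X)) lam) = 0 := by
    rw [← range_eq_Ico, ← h.charpoly_eq, aeval_self_charpoly]
  rw [nodal_Ico_eq_mul lam Fintype.card_pos, h.apply_zero hP, map_mul, map_sub, aeval_X, map_one,
    map_one, sub_mul, one_mul, sub_eq_zero] at h_zero
  rw [localEquilibrium, mul_smul_comm, h_zero]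

theorem pow_mul_localEquilibrium_one [Nonempty X] (h : IsMWSpectrum P lam)
    (hP : P ∈ rowStochastic ℝ X) (t : ℕ) :
    P ^ t * localEquilibrium P lam 1 = localEquilibrium P lam 1 := by
  induction t with
  | zero => rw [pow_zero, one_mul]
  | succ t ih => rw [pow_succ, mul_assoc, h.mul_localEquilibrium_one hP, ih]

theorem isStationary_localEquilibrium_one [Nonempty X] (h : IsMWSpectrum P lam)
    (hP : P ∈ rowStochastic ℝ X) (hβ : betaStar P < 1) (x : X) :
    IsStationary P (localEquilibrium P lam 1 x) := by
  refine isStationary_apply_of_mul_eq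
    (h.localEquilibrium_mem_rowStochastic hP Fintype.card_pos fun i hi =>
      (abs_le.1 (h.abs_apply_le_betaStar hP hi)).2.trans_lt hβ) ?_ x
  rw [← (commute_localEquilibrium P lam 1).eq, h.mul_localEquilibrium_one hP]

end IsMWSpectrum

theorem exists_isStationary [Nonempty X] (hP : P ∈ closure (reversibleChains X))
    (hβ : betaStar P < 1) : ∃ π, IsStationary P π := by
  obtain ⟨lam, hlam⟩ := exists_isMWSpectrum_of_mem_closure hP
  exact ⟨_, hlam.isStationary_localEquilibrium_one (mem_rowStochastic_of_mem_closure hP) hβ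
    (Classical.arbitrary X)⟩

theorem IsStationary.eq_of_betaStar_lt_one {π π' : X → ℝ} (hβ : betaStar P < 1)
    (hπ : IsStationary P π) (hπ' : IsStationary P π') : π = π' :=
  hπ.eq_of_rootMultiplicity_le_one (rootMultiplicity_one_le_one hβ) hπ'

end LocalEquilibria

/-! ### Mixing of chains with nonnegative eigenvalues -/

section TotalVariation

variable {X : Type*} [Fintype X]

theorem tvDist_self (μ : X → ℝ) : tvDist μ μ = 0 := by
  simp [tvDist]

theorem tvDist_le_one {μ ν : X → ℝ} (hμ : μ ∈ stdSimplex ℝ X) (hν : ν ∈ stdSimplex ℝ X) :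
    tvDist μ ν ≤ 1 := by
  have h_sum : ∑ x, |μ x - ν x| ≤ ∑ x, (μ x + ν x) :=
    sum_le_sum fun x _ => abs_sub_le_iff.2 ⟨by linarith [hν.1 x], by linarith [hμ.1 x]⟩
  rw [sum_add_distrib, hμ.2, hν.2] at h_sum
  rw [tvDist]
  linarith

theorem tvDist_convexComb_le {a b : ℝ} (ha : 0 ≤ a) (hb : 0 ≤ b) (hab : a + b = 1)
    (μ μ' ν : X → ℝ) :
    tvDist (a • μ + b • μ') ν ≤ a * tvDist μ ν + b * tvDist μ' ν := by
  have h_sum : ∑ x, |(a • μ + b • μ') x - ν x| ≤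
      a * ∑ x, |μ x - ν x| + b * ∑ x, |μ' x - ν x| := by
    rw [mul_sum, mul_sum, ← sum_add_distrib]
    refine sum_le_sum fun x _ => ?_
    calc |(a • μ + b • μ') x - ν x|
        = |a * (μ x - ν x) + b * (μ' x - ν x)| := by
          congr 1
          simp only [Pi.add_apply, Pi.smul_apply, smul_eq_mul]
          linear_combination ν x * hab
      _ ≤ |a * (μ x - ν x)| + |b * (μ' x - ν x)| := abs_add_le _ _
      _ = a * |μ x - ν x| + b * |μ' x - ν x| := by
          rw [abs_mul, abs_mul, abs_of_nonneg ha, abs_of_nonneg hb]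
  simp only [tvDist]
  linarith

end TotalVariation

section Chernoff

/-- `D t j` is dominated by the probability that a sum of `j` independent geometric variables
exceeds `t`; the bound on `D t (j + 1)` is the Chernoff bound for that sum. -/
theorem le_pow_mul_pow_of_recursion {D : ℕ → ℕ → ℝ} {l : ℕ → ℝ} {β c : ℝ} {m : ℕ}
    (hD_zero : ∀ t, D t 0 ≤ 0) (hD_init : ∀ j ≤ m, D 0 j ≤ 1)
    (hD_succ : ∀ t, ∀ j < m, D (t + 1) (j + 1) ≤ l j * D t (j + 1) + (1 - l j) * D t j)
    (hl : ∀ j < m, l j ∈ Set.Icc 0 β) (hβ : β ≤ 1) (hc : 1 ≤ c) (t : ℕ) {j : ℕ} (hj : j < m) :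
    D t (j + 1) ≤ c ^ j * (β + (1 - β) * c⁻¹) ^ t := by
  have hc_pos : 0 < c := one_pos.trans_le hc
  have hc_inv : c⁻¹ ≤ 1 := inv_le_one_of_one_le₀ hc
  set ρ := β + (1 - β) * c⁻¹ with hρ
  have hρ_nonneg : 0 ≤ ρ :=
    add_nonneg ((hl j hj).1.trans (hl j hj).2) (mul_nonneg (sub_nonneg.2 hβ) (inv_pos.2 hc_pos).le)
  have hlρ {i : ℕ} (hi : i < m) : l i + (1 - l i) * c⁻¹ ≤ ρ := by
    rw [hρ]
    nlinarith [(hl i hi).2]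
  induction t generalizing j with
  | zero => simpa using (hD_init (j + 1) hj).trans (one_le_pow₀ hc)
  | succ t ih =>
    obtain ⟨hl_nonneg, hl_le⟩ := hl j hj
    have h_prev : D t j ≤ c ^ j * ρ ^ t * c⁻¹ := by
      rcases j with - | j
      · exact (hD_zero t).trans (by positivity)
      · refine (ih (Nat.lt_of_succ_lt hj)).trans_eq ?_
        rw [pow_succ]
        field_simp
    calc D (t + 1) (j + 1)
        ≤ l j * D t (j + 1) + (1 - l j) * D t j := hD_succ t j hj
      _ ≤ l j * (c ^ j * ρ ^ t) + (1 - l j) * (c ^ j * ρ ^ t * c⁻¹) :=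
          add_le_add (mul_le_mul_of_nonneg_left (ih hj) hl_nonneg)
            (mul_le_mul_of_nonneg_left h_prev (sub_nonneg.2 (hl_le.trans hβ)))
      _ = c ^ j * ρ ^ t * (l j + (1 - l j) * c⁻¹) := by ring
      _ ≤ c ^ j * ρ ^ t * ρ := mul_le_mul_of_nonneg_left (hlρ hj) (by positivity)
      _ = c ^ j * ρ ^ (t + 1) := by ring

theorem div_pow_mul_exp_le {m : ℕ} {μ : ℝ} (hm : 0 < m) (hμ : m ≤ μ) :
    (μ / m) ^ m * Real.exp (-(μ - m)) ≤ Real.exp (-((μ - m) ^ 2 / (2 * μ))) := by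
  have hm_pos : (0 : ℝ) < m := Nat.cast_pos.2 hm
  have hμ_pos : 0 < μ := hm_pos.trans_le hμ
  have h_ratio : 0 < μ / m := div_pos hμ_pos hm_pos
  have h_log : Real.log (μ / m) ≤ (μ / m - (μ / m)⁻¹) / 2 := by
    rw [← Real.sinh_log h_ratio]
    exact Real.self_le_sinh_iff.2 (Real.log_nonneg ((one_le_div hm_pos).2 hμ))
  rw [← Real.exp_log (pow_pos h_ratio m), Real.log_pow, ← Real.exp_add, Real.exp_le_exp]
  calc m * Real.log (μ / m) + -(μ - m)
      ≤ m * ((μ / m - (μ / m)⁻¹) / 2) + -(μ - m) := by gcongr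
    _ = -((μ - m) ^ 2 / (2 * μ)) := by
        field_simp
        ring

theorem two_mul_mul_le_sub_sq {a L μ : ℝ} (ha : 0 ≤ a) (hL : 0 ≤ L)
    (hμ : a + 2 * L + √(2 * a * L) ≤ μ) : 2 * L * μ ≤ (μ - a) ^ 2 := by
  have h_sqrt : √(2 * a * L) ^ 2 = 2 * a * L := Real.sq_sqrt (by positivity)
  nlinarith [Real.sqrt_nonneg (2 * a * L)]

theorem exists_pow_mul_exp_le (m : ℕ) {L μ : ℝ} (hL : 0 < L)
    (hμ : m + 2 * L + √(2 * m * L) ≤ μ) :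
    ∃ c : ℝ, 1 ≤ c ∧ c ^ m * Real.exp (-(μ * (1 - c⁻¹))) ≤ Real.exp (-L) := by
  have h_sqrt : 0 ≤ √(2 * m * L) := Real.sqrt_nonneg _
  rcases m.eq_zero_or_pos with rfl | hm
  · refine ⟨2, one_le_two, ?_⟩
    rw [pow_zero, one_mul, Real.exp_le_exp]
    push_cast at hμ h_sqrt
    linarith
  · have hm_pos : (0 : ℝ) < m := Nat.cast_pos.2 hm
    have hmμ : (m : ℝ) ≤ μ := by linarith
    have hμ_pos : 0 < μ := hm_pos.trans_le hmμ
    refine ⟨μ / m, (one_le_div hm_pos).2 hmμ, ?_⟩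
    have h_exponent : μ * (1 - (μ / m)⁻¹) = μ - m := by field_simp
    rw [h_exponent]
    refine (div_pow_mul_exp_le hm hmμ).trans (Real.exp_le_exp.2 (neg_le_neg ?_))
    rw [le_div_iff₀ (by positivity)]
    linarith [two_mul_mul_le_sub_sq hm_pos.le hL.le hμ]

/-- The constant `N + 2 L - 1 + √(2 (N - 2) L)`, `L = log ε⁻¹`, bounding the mixing time of a chain
with `N` states and nonnegative eigenvalues in units of its relaxation time. -/
noncomputable def mixingConstant (N : ℕ) (ε : ℝ) : ℝ :=
  (N : ℝ) + 2 * Real.log ε⁻¹ - 1 + √(2 * ((N : ℝ) - 2) * Real.log ε⁻¹)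

theorem mixingConstant_add_two (m : ℕ) (ε : ℝ) :
    mixingConstant (m + 2) ε = m + 2 * Real.log ε⁻¹ + √(2 * m * Real.log ε⁻¹) + 1 := by
  rw [mixingConstant, Nat.cast_add, Nat.cast_ofNat, add_sub_cancel_right]
  ring

theorem mixingConstant_nonneg {N : ℕ} (hN : 2 ≤ N) {ε : ℝ} (hε : 0 < ε) (hε_le : ε ≤ 1) :
    0 ≤ mixingConstant N ε := by
  obtain ⟨m, rfl⟩ := Nat.exists_eq_add_of_le' hN
  have h_log : 0 ≤ Real.log ε⁻¹ := Real.log_nonneg ((one_le_inv₀ hε).2 hε_le)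
  rw [mixingConstant_add_two]
  positivity

end Chernoff

section Mixing

variable {X : Type*} [Fintype X] [DecidableEq X] {P : Matrix X X ℝ} {lam : ℕ → ℝ} {π : X → ℝ}

theorem IsMWSpectrum.tvDist_pow_le [Nonempty X] (h : IsMWSpectrum P lam)
    (hP : P ∈ rowStochastic ℝ X) (hβ : betaStar P < 1)
    (hlam : ∀ i ∈ Ico 1 (Fintype.card X), 0 ≤ lam i) (hπ : IsStationary P π) {c : ℝ} (hc : 1 ≤ c)
    {m : ℕ} (hm : Fintype.card X = m + 2) (t : ℕ) (x : X) :
    tvDist ((P ^ t) x) π ≤ c ^ m * (betaStar P + (1 - betaStar P) * c⁻¹) ^ t := by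
  have h_mem {j : ℕ} (hj : j < m + 1) : j + 1 ∈ Ico 1 (Fintype.card X) := by
    rw [mem_Ico]
    omega
  have hlam_Icc (i : ℕ) (hi : i ∈ Ico 1 (Fintype.card X)) : lam i ∈ Set.Icc 0 (betaStar P) :=
    ⟨hlam i hi, (abs_le.1 (h.abs_apply_le_betaStar hP hi)).2⟩
  have hlam_lt (i : ℕ) (hi : i ∈ Ico 1 (Fintype.card X)) : lam i < 1 :=
    (hlam_Icc i hi).2.trans_lt hβ
  have h_stoch {j : ℕ} (hj : j ≤ m + 1) : localEquilibrium P lam (j + 1) ∈ rowStochastic ℝ X :=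
    h.localEquilibrium_mem_rowStochastic hP (by omega) fun i hi =>
      hlam_lt i (Ico_subset_Ico_left (Nat.succ_le_succ j.zero_le) hi)
  let D (t j : ℕ) : ℝ := tvDist ((P ^ t * localEquilibrium P lam (j + 1)) x) π
  have hD_zero (t : ℕ) : D t 0 ≤ 0 := by
    simp only [D, zero_add]
    rw [h.pow_mul_localEquilibrium_one hP,
      (h.isStationary_localEquilibrium_one hP hβ x).eq_of_betaStar_lt_one hβ hπ, tvDist_self]
  have hD_init (j : ℕ) (hj : j ≤ m + 1) : D 0 j ≤ 1 := by
    simp only [D, pow_zero, one_mul]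
    exact tvDist_le_one ⟨fun _ => nonneg_of_mem_rowStochastic (h_stoch hj),
      sum_row_of_mem_rowStochastic (h_stoch hj) x⟩ hπ.1
  have hD_succ (t j : ℕ) (hj : j < m + 1) :
      D (t + 1) (j + 1) ≤ lam (j + 1) * D t (j + 1) + (1 - lam (j + 1)) * D t j := by
    simp only [D]
    rw [pow_succ_mul_localEquilibrium_succ (by omega) (hlam_lt _ (h_mem hj)).ne]
    exact tvDist_convexComb_le (hlam _ (h_mem hj)) (sub_nonneg.2 (hlam_lt _ (h_mem hj)).le)
      (add_sub_cancel _ _) _ _ _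
  have hD_last : D t (m + 1) = tvDist ((P ^ t) x) π := by
    simp only [D]
    rw [← hm, localEquilibrium_card, mul_one]
  rw [← hD_last]
  exact le_pow_mul_pow_of_recursion hD_zero hD_init hD_succ
    (fun _ hj => hlam_Icc _ (h_mem hj)) hβ.le hc t m.lt_succ_self

theorem IsMWSpectrum.mem_mixedTimes [Nonempty X] (h : IsMWSpectrum P lam)
    (hP : P ∈ rowStochastic ℝ X) (hβ : betaStar P < 1)
    (hlam : ∀ i ∈ Ico 1 (Fintype.card X), 0 ≤ lam i) (hπ : IsStationary P π) {m : ℕ}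
    (hm : Fintype.card X = m + 2) {ε : ℝ} (hε : 0 < ε) (hε_lt : ε < 1) {t : ℕ}
    (ht : m + 2 * Real.log ε⁻¹ + √(2 * m * Real.log ε⁻¹) ≤ t * (1 - betaStar P)) :
    t ∈ mixedTimes P π ε := by
  intro x
  obtain ⟨c, hc, hcε⟩ := exists_pow_mul_exp_le m (Real.log_pos ((one_lt_inv₀ hε).2 hε_lt)) ht
  have hc_inv : 0 < c⁻¹ := inv_pos.2 (one_pos.trans_le hc)
  set β := betaStar P
  have hρ_nonneg : 0 ≤ β + (1 - β) * c⁻¹ :=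
    add_nonneg (betaStar_nonneg P) (mul_nonneg (sub_nonneg.2 hβ.le) hc_inv.le)
  have hρ_le : β + (1 - β) * c⁻¹ ≤ Real.exp (-((1 - β) * (1 - c⁻¹))) := by
    linarith [Real.add_one_le_exp (-((1 - β) * (1 - c⁻¹)))]
  calc tvDist ((P ^ t) x) π
      ≤ c ^ m * (β + (1 - β) * c⁻¹) ^ t := h.tvDist_pow_le hP hβ hlam hπ hc hm t x
    _ ≤ c ^ m * Real.exp (-((1 - β) * (1 - c⁻¹))) ^ t := by gcongr
    _ = c ^ m * Real.exp (-(t * (1 - β) * (1 - c⁻¹))) := by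
        rw [← Real.exp_nat_mul]
        ring_nf
    _ ≤ Real.exp (-Real.log ε⁻¹) := hcε
    _ = ε := by rw [Real.log_inv, neg_neg, Real.exp_log hε]

theorem exists_mem_mixedTimes_le (hP : P ∈ closure (reversibleChains X)) (hβ : betaStar P < 1)
    (hP_nonneg : ∀ z ∈ eigenvalues P, ∃ r : ℝ, 0 ≤ r ∧ z = r) (hX : 2 ≤ Fintype.card X)
    (hπ : IsStationary P π) {ε : ℝ} (hε : 0 < ε) (hε_lt : ε < 1) :
    ∃ t ∈ mixedTimes P π ε, (t : ℝ) ≤ mixingConstant (Fintype.card X) ε * tRel P := by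
  have : Nonempty X := Fintype.card_pos_iff.1 (two_pos.trans_le hX)
  have hP_stoch := mem_rowStochastic_of_mem_closure hP
  obtain ⟨lam, h⟩ := exists_isMWSpectrum_of_mem_closure hP
  have hlam (i : ℕ) (hi : i ∈ Ico 1 (Fintype.card X)) : 0 ≤ lam i := by
    obtain ⟨r, hr, hr_eq⟩ := hP_nonneg _
      (Multiset.mem_of_mem_erase (h.ofReal_mem_erase_eigenvalues hP_stoch hi))
    rwa [Complex.ofReal_inj.1 hr_eq]
  obtain ⟨m, hm⟩ := Nat.exists_eq_add_of_le' hX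
  have h_gap : 0 < 1 - betaStar P := sub_pos.2 hβ
  refine ⟨⌊mixingConstant (Fintype.card X) ε * tRel P⌋₊,
    h.mem_mixedTimes hP_stoch hβ hlam hπ hm hε hε_lt ?_, Nat.floor_le <|
      mul_nonneg (mixingConstant_nonneg hX hε hε_lt.le) (one_div_pos.2 h_gap).le⟩
  have h_floor := (Nat.lt_floor_add_one (mixingConstant (Fintype.card X) ε * tRel P)).le
  rw [tRel, mul_one_div, div_le_iff₀ h_gap, hm, mixingConstant_add_two] at h_floor
  rw [tRel, mul_one_div, hm, mixingConstant_add_two]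
  linarith [betaStar_nonneg P]

theorem eigenvalues_sq_nonneg (hP : P ∈ closure (reversibleChains X)) :
    ∀ z ∈ eigenvalues (P ^ 2), ∃ r : ℝ, 0 ≤ r ∧ z = r := by
  obtain ⟨lam, h⟩ := exists_isMWSpectrum_of_mem_closure hP
  intro z hz
  rw [eigenvalues_sq, h.eigenvalues_eq_map, Multiset.map_map] at hz
  obtain ⟨i, -, rfl⟩ := Multiset.mem_map.1 hz
  exact ⟨lam i ^ 2, sq_nonneg _, (Complex.ofReal_pow _ _).symm⟩

theorem betaStar_sq_le_betaStar [Nonempty X] (hP : P ∈ rowStochastic ℝ X) (hβ : betaStar P ≤ 1) :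
    betaStar (P ^ 2) ≤ betaStar P :=
  (betaStar_sq_le hP).trans (pow_le_of_le_one (betaStar_nonneg P) hβ two_ne_zero)

theorem two_mul_mem_mixedTimes {ε : ℝ} {t : ℕ} (ht : t ∈ mixedTimes (P ^ 2) π ε) :
    2 * t ∈ mixedTimes P π ε := fun x => by
  rw [pow_mul]
  exact ht x

/-- Squaring the chain makes the eigenvalues nonnegative without decreasing the spectral gap. -/
theorem exists_mem_mixedTimes_le_two_mul (hP : P ∈ closure (reversibleChains X))
    (hβ : betaStar P < 1) (hX : 2 ≤ Fintype.card X) (hπ : IsStationary P π) {ε : ℝ} (hε : 0 < ε)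
    (hε_lt : ε < 1) :
    ∃ t ∈ mixedTimes P π ε, (t : ℝ) ≤ 2 * mixingConstant (Fintype.card X) ε * tRel P := by
  have : Nonempty X := Fintype.card_pos_iff.1 (two_pos.trans_le hX)
  have hβ_sq : betaStar (P ^ 2) ≤ betaStar P :=
    betaStar_sq_le_betaStar (mem_rowStochastic_of_mem_closure hP) hβ.le
  have h_tRel : tRel (P ^ 2) ≤ tRel P :=
    one_div_le_one_div_of_le (sub_pos.2 hβ) (sub_le_sub_left hβ_sq 1)
  obtain ⟨t, ht, ht_le⟩ := exists_mem_mixedTimes_le (sq_mem_closure_reversibleChains hP)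
    (hβ_sq.trans_lt hβ) (eigenvalues_sq_nonneg hP) hX hπ.sq hε hε_lt
  refine ⟨2 * t, two_mul_mem_mixedTimes ht, ?_⟩
  calc ((2 * t : ℕ) : ℝ)
      = 2 * t := by push_cast; rfl
    _ ≤ 2 * (mixingConstant (Fintype.card X) ε * tRel P) := by
        gcongr
        exact ht_le.trans (mul_le_mul_of_nonneg_left h_tRel (mixingConstant_nonneg hX hε hε_lt.le))
    _ = 2 * mixingConstant (Fintype.card X) ε * tRel P := (mul_assoc _ _ _).symm

end Mixing

end MarkovMixing

theorem theorem1p3 {X : Type*} [Fintype X] [DecidableEq X] (N : ℕ)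
    (hN : Fintype.card X = N) (hN2 : 2 ≤ N) (P : Matrix X X ℝ)
    (hP : P ∈ closure (MarkovMixing.reversibleChains X))
    (hβ : MarkovMixing.betaStar P < 1) :
    ∃ π : X → ℝ, MarkovMixing.IsStationary P π ∧
      (∀ π' : X → ℝ, MarkovMixing.IsStationary P π' → π' = π) ∧
      ∀ ε : ℝ, 0 < ε → ε < 1 →
        (MarkovMixing.mixedTimes P π ε).Nonempty ∧
        (MarkovMixing.tMix P π ε : ℝ) ≤
          2 * ((N : ℝ) + 2 * Real.log ε⁻¹ - 1 + √(2 * ((N : ℝ) - 2) * Real.log ε⁻¹)) *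
            MarkovMixing.tRel P ∧
        ((∀ z ∈ MarkovMixing.eigenvalues P, ∃ r : ℝ, 0 ≤ r ∧ z = (r : ℂ)) →
          (MarkovMixing.tMix P π ε : ℝ) ≤
            ((N : ℝ) + 2 * Real.log ε⁻¹ - 1 + √(2 * ((N : ℝ) - 2) * Real.log ε⁻¹)) *
              MarkovMixing.tRel P) := by
  open MarkovMixing in
  subst hN
  have : Nonempty X := Fintype.card_pos_iff.1 (two_pos.trans_le hN2)
  obtain ⟨π, hπ⟩ := exists_isStationary hP hβ
  refine ⟨π, hπ, fun π' hπ' => hπ'.eq_of_betaStar_lt_one hβ hπ, fun ε hε hε_lt => ?_⟩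
  have h_tMix {t : ℕ} (ht : t ∈ mixedTimes P π ε) : (tMix P π ε : ℝ) ≤ t :=
    Nat.cast_le.2 (Nat.sInf_le ht)
  obtain ⟨t, ht, ht_le⟩ := exists_mem_mixedTimes_le_two_mul hP hβ hN2 hπ hε hε_lt
  refine ⟨⟨t, ht⟩, (h_tMix ht).trans ht_le, fun hP_nonneg => ?_⟩
  obtain ⟨s, hs, hs_le⟩ := exists_mem_mixedTimes_le hP hβ hP_nonneg hN2 hπ hε hε_lt
  exact (h_tMix hs).trans hs_le
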